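/- For $m\ge 2$ let $\mathcal T_m$ be the rooted $m$-regular tree, whose vertices are the finite words over an alphabet of $m$ letters, and let $\mathcal A_m$ be its automorphism group. For $\alpha\in\mathcal A_m$ and a word $u$, the state $\alpha_u\in\mathcal A_m$ is the automorphism determined by $\alpha(uv)=\alpha(u)\,\alpha_u(v)$ for all words $v$; $\alpha$ is called finite-state if its set of states $Q(\alpha)=\{\alpha_u\}_u$ is finite. A group is called finite-state if, for some $m\ge 2$, it is isomorphic to a subgroup of $\mathcal A_m$ all of whose elements are finite-state. Write $A\wr G=A^{(G)}\rtimes G$ for the restricted regular wreath product (functions $G\to A$ of finite support). Let $A$ be a finitely generated abelian group. Then the group $A\wr(C_2\wr\mathbb Z)$ is finite-state. In particular, the groups $C_2\wr(C_2\wr\mathbb Z)$ and $\mathbb Z\wr(C_2\wr\mathbb Z)$ are finite-state. -/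

import Mathlib

/-- The automorphism group `𝒜_m` of the rooted `m`-regular tree, whose vertices are the finite words
over the alphabet `Fin m` (the root is the empty word, and the subtree hanging at `u` consists of the
words with prefix `u`): the bijections of the vertex set that preserve levels and the prefix order. -/
def TreeAut (m : ℕ) : Subgroup (Equiv.Perm (List (Fin m))) where
  carrier := {e | (∀ u, (e u).length = u.length) ∧ ∀ u v, e u <+: e v ↔ u <+: v}
  one_mem' := by simp
  mul_mem' := by
    rintro a b ⟨ha, ha'⟩ ⟨hb, hb'⟩
    exact ⟨fun u => by simp [ha, hb], fun u v => by simp [ha', hb']⟩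
  inv_mem' := by
    rintro a ⟨ha, ha'⟩
    refine ⟨fun u => ?_, fun u v => ?_⟩
    · simpa using (ha (a⁻¹ u)).symm
    · simpa using (ha' (a⁻¹ u) (a⁻¹ v)).symm

namespace TreeAut

variable {m : ℕ}

theorem length_apply (α : TreeAut m) (u : List (Fin m)) : (α.1 u).length = u.length :=
  α.2.1 u

theorem append_drop (α : TreeAut m) (u v : List (Fin m)) :
    α.1 u ++ (α.1 (u ++ v)).drop u.length = α.1 (u ++ v) := by
  obtain ⟨w, hw⟩ := (α.2.2 u (u ++ v)).2 (List.prefix_append u v)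
  rw [← hw, ← length_apply α u, List.drop_left]

/-- The state `α_u` of `α` at the vertex `u`, as an automorphism of the tree: the action of `α` from
the subtree at `u` to the subtree at `α u`, both subtrees being identified with the whole tree.
It is determined by `α (u ++ v) = α u ++ α_u v`, see `apply_append`. -/
def state (α : TreeAut m) (u : List (Fin m)) : TreeAut m where
  val :=
    { toFun := fun v => (α.1 (u ++ v)).drop u.length
      invFun := fun v => (α.1.symm (α.1 u ++ v)).drop u.length
      left_inv := fun v => by simp [append_drop]
      right_inv := fun v => by
        have h : α.1.symm (α.1 u) ++ (α.1.symm (α.1 u ++ v)).drop (α.1 u).length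
            = α.1.symm (α.1 u ++ v) := append_drop α⁻¹ (α.1 u) v
        rw [Equiv.symm_apply_apply, length_apply] at h
        simp only [h, Equiv.apply_symm_apply]
        rw [← length_apply α u, List.drop_left] }
  property := by
    refine ⟨fun v => ?_, fun v w => ?_⟩
    · simp [length_apply]
    · simp only [Equiv.coe_fn_mk]
      rw [← List.prefix_append_right_inj (α.1 u), append_drop, append_drop, α.2.2,
        List.prefix_append_right_inj]

theorem apply_append (α : TreeAut m) (u v : List (Fin m)) :
    α.1 (u ++ v) = α.1 u ++ (state α u).1 v :=
  (append_drop α u v).symm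

/-- The set `Q(α)` of states of `α`. -/
def states (α : TreeAut m) : Set (TreeAut m) := Set.range (state α)

/-- An automorphism of the tree is finite-state if its set of states is finite. -/
def IsFiniteState (α : TreeAut m) : Prop := (states α).Finite

end TreeAut

/-- A group is finite-state if, for some `m ≥ 2`, it has a faithful representation by finite-state
automorphisms of the `m`-regular rooted tree, that is, if it is isomorphic to a subgroup of `ℱ_m`. -/
def IsFiniteStateGroup (G : Type*) [Group G] : Prop :=
  ∃ m : ℕ, 2 ≤ m ∧ ∃ φ : G →* TreeAut m,
    Function.Injective φ ∧ ∀ g : G, TreeAut.IsFiniteState (φ g)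

/-- The restricted wreath product `D ≀ Q = D^{(Q)} ⋊ Q`, as the subgroup of the unrestricted regular
wreath product formed by the pairs whose function `Q → D` has finite support. -/
def restrictedWreath (D Q : Type*) [Group D] [Group Q] : Subgroup (RegularWreathProduct D Q) where
  carrier := {x | (Function.mulSupport x.left).Finite}
  one_mem' := by simp
  mul_mem' := by
    intro a b ha hb
    simp only [Set.mem_ofPred_eq] at ha hb ⊢
    rw [RegularWreathProduct.mul_left]
    refine Set.Finite.subset (ha.union ?_) (Function.mulSupport_mul _ _)
    exact hb.preimage (f := fun x => a.right⁻¹ * x) (mul_right_injective _).injOn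
  inv_mem' := by
    intro a ha
    simp only [Set.mem_ofPred_eq] at ha ⊢
    rw [RegularWreathProduct.inv_left]
    refine Set.Finite.subset
      (ha.preimage (f := fun x => a.right * x) (mul_right_injective _).injOn) ?_
    intro x hx
    simpa using hx

/-- The restricted wreath product `D ≀ Q`, as a type. -/
abbrev RestrictedWreath (D Q : Type*) [Group D] [Group Q] : Type _ := ↥(restrictedWreath D Q)

/-- The cyclic group of order two, written multiplicatively. -/
abbrev CyclicTwo : Type := Multiplicative (ZMod 2)

/-- The infinite cyclic group, written multiplicatively. -/
abbrev CyclicInf : Type := Multiplicative ℤ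

/-! Groups are made to act on infinite sequences over a finite alphabet by maps computed by finite
Mealy machines; restricting to prefixes gives tree automorphisms, whose states are among the states
of the machine.

Let `Q` act in this way on sequences `x`, and let `χ` be a finite-state test giving a bit `χ x N` at
each time `N`. Suppose that for every finite `F ⊆ Q` without `1` some `x` and `N` pass the test
while all `q x`, `q ∈ F`, fail it at time `N`. If `A` is abelian with a finite-state action on
sequences `y`, then `A ≀ Q` acts on triples `(x, b, y)`: an element `(f, q)` sends `x` to `q x`,
fixes the binary sequence `b`, and, where `N` is the first time with `b N = true`, acts on the tail
of `y` from `N` on by the product of those `f p` for which `p⁻¹ q x` passes the test at time `N`.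
Commutativity of `A` makes this an action, finiteness of the support of `f` makes it finite-state,
and the separation property, which isolates a single value `f p₀`, makes it faithful
(`FiniteStateAction.wreath`).

For `Q = C₂ ≀ ℤ`, identified with `𝔽₂[t, t⁻¹] ⋊ ℤ`, put `t = 1 + X` and let `Q` act on `𝔽₂⟦X⟧` by
affine maps `p ↦ t ^ n * p + g`. The test asks that at most one coefficient before time `N` be
nonzero. A nontrivial `q` sends only finitely many monomials `X ^ n` to zero or a monomial
(`finite_setOf_sparse_lampAct`), so any large `n` separates. -/

/-! ### Mealy machines and finite-state maps on sequences. -/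

/-- A Mealy machine with input alphabet `X`, output alphabet `Y` and set of states `σ`. -/
structure Mealy (X Y σ : Type) where
  /-- The transition function. -/
  next : σ → X → σ
  /-- The output function. -/
  out : σ → X → Y

namespace Mealy

variable {X Y Z σ τ : Type}

/-- The sequence of states visited from `q` on the input `s`. -/
def trace (M : Mealy X Y σ) (q : σ) (s : ℕ → X) : ℕ → σ
  | 0 => q
  | n + 1 => M.next (trace M q s n) (s n)

/-- The map on sequences computed by a Mealy machine from the state `q`. -/
def run (M : Mealy X Y σ) (q : σ) (s : ℕ → X) (n : ℕ) : Y :=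
  M.out (M.trace q s n) (s n)

/-- The map on words computed by a Mealy machine from the state `q`. -/
def runList (M : Mealy X Y σ) : σ → List X → List Y
  | _, [] => []
  | q, x :: v => M.out q x :: runList M (M.next q x) v

theorem trace_succ' (M : Mealy X Y σ) (q : σ) (s : ℕ → X) (n : ℕ) :
    M.trace q s (n + 1) = M.trace (M.next q (s 0)) (fun k => s (k + 1)) n := by
  induction n with
  | zero => rfl
  | succ n ih => rw [trace, ih]; rfl

theorem run_succ (M : Mealy X Y σ) (q : σ) (s : ℕ → X) (n : ℕ) :
    M.run q s (n + 1) = M.run (M.next q (s 0)) (fun k => s (k + 1)) n := by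
  rw [run, trace_succ', run]

theorem runList_append (M : Mealy X Y σ) (q : σ) (u v : List X) :
    M.runList q (u ++ v) = M.runList q u ++ M.runList (u.foldl M.next q) v := by
  induction u generalizing q with
  | nil => rfl
  | cons x u ih => simp [runList, ih]

theorem trace_congr (M : Mealy X Y σ) (q : σ) {s s' : ℕ → X} {n : ℕ} (h : ∀ i < n, s i = s' i) :
    M.trace q s n = M.trace q s' n := by
  induction n with
  | zero => rfl
  | succ n ih => rw [trace, trace, ih fun i hi => h i (hi.trans n.lt_succ_self), h n n.lt_succ_self]

theorem run_congr (M : Mealy X Y σ) (q : σ) {s s' : ℕ → X} {n : ℕ} (h : ∀ i ≤ n, s i = s' i) :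
    M.run q s n = M.run q s' n := by
  rw [run, run, M.trace_congr q fun i hi => h i hi.le, h n le_rfl]

/-- The cascade of two machines, the second one reading the output of the first one. -/
def comp (N : Mealy Y Z τ) (M : Mealy X Y σ) : Mealy X Z (σ × τ) where
  next q x := (M.next q.1 x, N.next q.2 (M.out q.1 x))
  out q x := N.out q.2 (M.out q.1 x)

theorem trace_comp (N : Mealy Y Z τ) (M : Mealy X Y σ) (q : σ) (p : τ) (s : ℕ → X) (n : ℕ) :
    (N.comp M).trace (q, p) s n = (M.trace q s n, N.trace p (M.run q s) n) := by
  induction n with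
  | zero => rfl
  | succ n ih => rw [trace, ih]; rfl

/-- Finitely many machines running in parallel on their own components of the input. -/
def pi {ι : Type} {X Y σ : ι → Type} (M : ∀ i, Mealy (X i) (Y i) (σ i)) :
    Mealy (∀ i, X i) (∀ i, Y i) (∀ i, σ i) where
  next q x i := (M i).next (q i) (x i)
  out q x i := (M i).out (q i) (x i)

theorem trace_pi {ι : Type} {X Y σ : ι → Type} (M : ∀ i, Mealy (X i) (Y i) (σ i)) (q : ∀ i, σ i)
    (s : ℕ → ∀ i, X i) (n : ℕ) :
    (pi M).trace q s n = fun i => (M i).trace (q i) (fun k => s k i) n := by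
  induction n with
  | zero => rfl
  | succ n ih => rw [trace, ih]; rfl

/-- Two machines running in parallel on the same input. -/
def pair (M : Mealy X Y σ) (N : Mealy X Z τ) : Mealy X (Y × Z) (σ × τ) where
  next q x := (M.next q.1 x, N.next q.2 x)
  out q x := (M.out q.1 x, N.out q.2 x)

theorem trace_pair (M : Mealy X Y σ) (N : Mealy X Z τ) (q : σ) (p : τ) (s : ℕ → X) (n : ℕ) :
    (M.pair N).trace (q, p) s n = (M.trace q s n, N.trace p s n) := by
  induction n with
  | zero => rfl
  | succ n ih => rw [trace, ih]; rfl

end Mealy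

/-- A map on sequences is finite-state if it is computed by a finite Mealy machine. -/
def FiniteStateMap {X Y : Type} (F : (ℕ → X) → ℕ → Y) : Prop :=
  ∃ (σ : Type) (_ : Finite σ) (M : Mealy X Y σ) (q : σ), ∀ s, F s = M.run q s

namespace FiniteStateMap

variable {X Y Z : Type}

theorem congr {F : (ℕ → X) → ℕ → Y} (hF : FiniteStateMap F) {s s' : ℕ → X} {n : ℕ}
    (h : ∀ i ≤ n, s i = s' i) : F s n = F s' n := by
  obtain ⟨σ, _, M, q, hM⟩ := hF
  rw [hM, hM, M.run_congr q h]

theorem comp {G : (ℕ → Y) → ℕ → Z} {F : (ℕ → X) → ℕ → Y} (hG : FiniteStateMap G)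
    (hF : FiniteStateMap F) : FiniteStateMap fun s => G (F s) := by
  obtain ⟨σ, _, M, q, hM⟩ := hF
  obtain ⟨τ, _, N, p, hN⟩ := hG
  refine ⟨σ × τ, inferInstance, N.comp M, (q, p), fun s => funext fun n => ?_⟩
  simp only [hM, hN, Mealy.run, Mealy.trace_comp]
  rfl

theorem pi {ι : Type} [Finite ι] {X Y : ι → Type} {F : ∀ i, (ℕ → X i) → ℕ → Y i}
    (hF : ∀ i, FiniteStateMap (F i)) :
    FiniteStateMap fun (s : ℕ → ∀ i, X i) n i => F i (fun k => s k i) n := by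
  choose σ hσ M q hM using hF
  refine ⟨∀ i, σ i, inferInstance, Mealy.pi M, q, fun s => funext fun n => ?_⟩
  rw [Mealy.run, Mealy.trace_pi]
  funext i
  simp only [hM]
  rfl

theorem prodMk {F : (ℕ → X) → ℕ → Y} {G : (ℕ → X) → ℕ → Z} (hF : FiniteStateMap F)
    (hG : FiniteStateMap G) : FiniteStateMap fun s n => (F s n, G s n) := by
  obtain ⟨σ, _, M, q, hM⟩ := hF
  obtain ⟨τ, _, N, p, hN⟩ := hG
  refine ⟨σ × τ, inferInstance, M.pair N, (q, p), fun s => funext fun n => ?_⟩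
  simp only [hM, hN, Mealy.run, Mealy.trace_pair]
  rfl

theorem map (f : X → Y) : FiniteStateMap fun (s : ℕ → X) n => f (s n) :=
  ⟨Unit, inferInstance, ⟨fun q _ => q, fun _ x => f x⟩, (), fun _ => rfl⟩

theorem id : FiniteStateMap fun s : ℕ → X => s := map fun x => x

theorem map_comp {F : (ℕ → X) → ℕ → Y} (hF : FiniteStateMap F) (f : Y → Z) :
    FiniteStateMap fun s n => f (F s n) :=
  (map f).comp hF

theorem map₂ {W : Type} {F : (ℕ → X) → ℕ → Y} {G : (ℕ → X) → ℕ → Z} (hF : FiniteStateMap F)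
    (hG : FiniteStateMap G) (f : Y → Z → W) : FiniteStateMap fun s n => f (F s n) (G s n) :=
  (hF.prodMk hG).map_comp fun p => f p.1 p.2

end FiniteStateMap

/-! ### From maps on infinite sequences to maps on finite words. -/

section Truncation

variable {X : Type} [Inhabited X]

/-- The sequence obtained from a word by adding default letters. -/
def padWord (w : List X) (n : ℕ) : X := w.getD n default

/-- The map on words induced by a non-expanding map on sequences. -/
def truncate (F : (ℕ → X) → ℕ → X) (w : List X) : List X :=
  List.ofFn fun i : Fin w.length => F (padWord w) i

theorem length_truncate (F : (ℕ → X) → ℕ → X) (w : List X) :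
    (truncate F w).length = w.length := by simp [truncate]

theorem padWord_truncate (F : (ℕ → X) → ℕ → X) (w : List X) {i : ℕ} (hi : i < w.length) :
    padWord (truncate F w) i = F (padWord w) i := by
  rw [padWord, List.getD_eq_getElem _ _ (by rwa [length_truncate])]
  simp [truncate]

theorem eq_of_padWord {u v : List X} (hl : u.length = v.length)
    (h : ∀ i < u.length, padWord u i = padWord v i) : u = v := by
  refine List.ext_getElem hl fun i hi hi' => ?_
  have := h i hi
  rwa [padWord, padWord, List.getD_eq_getElem _ _ hi, List.getD_eq_getElem _ _ hi'] at this

/-- Padding after truncation changes `G (padWord w)` only beyond the length of `w`, where the causal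
map `F` does not look. -/
theorem truncate_comp {F : (ℕ → X) → ℕ → X} (hF : FiniteStateMap F) (G : (ℕ → X) → ℕ → X)
    (w : List X) : truncate (fun s => F (G s)) w = truncate F (truncate G w) := by
  refine eq_of_padWord (by simp [length_truncate]) fun i hi => ?_
  rw [length_truncate] at hi
  rw [padWord_truncate _ _ hi, padWord_truncate _ _ (by rwa [length_truncate])]
  exact hF.congr fun j hj => (padWord_truncate _ _ (hj.trans_lt hi)).symm

theorem truncate_id (w : List X) : truncate (fun s => s) w = w := by
  refine eq_of_padWord (by simp [length_truncate]) fun i hi => ?_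
  rw [length_truncate] at hi
  rw [padWord_truncate _ _ hi]

theorem eq_of_truncate_eq {F G : (ℕ → X) → ℕ → X} (hF : FiniteStateMap F) (hG : FiniteStateMap G)
    (h : truncate F = truncate G) : F = G := by
  funext s n
  set w := List.ofFn fun i : Fin (n + 1) => s i with hw
  have hs : ∀ i ≤ n, s i = padWord w i := fun i hi => by
    rw [padWord, List.getD_eq_getElem _ _ (by simp [hw]; lia)]
    simp only [hw, List.getElem_ofFn]
  have hn : n < w.length := by simp [hw]
  rw [hF.congr hs, hG.congr hs, ← padWord_truncate F w hn, ← padWord_truncate G w hn, h]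

theorem Mealy.ofFn_run {σ : Type} (M : Mealy X X σ) (q : σ) (w : List X) :
    (List.ofFn fun i : Fin w.length => M.run q (padWord w) i) = M.runList q w := by
  induction w generalizing q with
  | nil => rfl
  | cons x w ih =>
    simp only [List.length_cons, List.ofFn_succ, Fin.val_zero, Fin.val_succ, Mealy.run_succ]
    exact congrArg₂ List.cons rfl (ih _)

theorem FiniteStateMap.exists_truncate_eq {F : (ℕ → X) → ℕ → X} (hF : FiniteStateMap F) :
    ∃ (σ : Type) (_ : Finite σ) (M : Mealy X X σ) (q : σ), truncate F = M.runList q := by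
  obtain ⟨σ, hσ, M, q, hM⟩ := hF
  exact ⟨σ, hσ, M, q, funext fun w => by rw [← M.ofFn_run, truncate, hM]⟩

theorem FiniteStateMap.truncate_prefix {F : (ℕ → X) → ℕ → X} (hF : FiniteStateMap F)
    {u v : List X} (h : u <+: v) : truncate F u <+: truncate F v := by
  obtain ⟨σ, _, M, q, hM⟩ := hF.exists_truncate_eq
  obtain ⟨w, rfl⟩ := h
  rw [hM, M.runList_append]
  exact List.prefix_append _ _

end Truncation

/-! ### Finite-state actions and the tree automorphisms they induce. -/

/-- A faithful action of a group by finite-state maps on the sequences over an alphabet `X`. -/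
structure FiniteStateAction (G : Type*) [Group G] (X : Type) where
  /-- The action. -/
  act : G → (ℕ → X) → ℕ → X
  act_one : ∀ s, act 1 s = s
  act_mul : ∀ g h s, act (g * h) s = act g (act h s)
  faithful : ∀ g, (∀ s, act g s = s) → g = 1
  finiteState : ∀ g, FiniteStateMap (act g)

namespace FiniteStateAction

section

variable {G : Type*} [Group G] {m : ℕ} [NeZero m]

/-- The action by permutations of the set of words induced by a finite-state action. -/
def wordHom (φ : FiniteStateAction G (Fin m)) : G →* Equiv.Perm (List (Fin m)) :=
  MonoidHom.toHomPerm
    { toFun := fun g => truncate (φ.act g)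
      map_one' := funext fun w => by rw [funext φ.act_one]; exact truncate_id w
      map_mul' := fun g h => funext fun w => by
        rw [funext (φ.act_mul g h)]; exact truncate_comp (φ.finiteState g) (φ.act h) w }

theorem wordHom_prefix (φ : FiniteStateAction G (Fin m)) (g : G) {u v : List (Fin m)}
    (h : u <+: v) : φ.wordHom g u <+: φ.wordHom g v :=
  (φ.finiteState g).truncate_prefix h

/-- The action by tree automorphisms induced by a finite-state action. -/
def treeHom (φ : FiniteStateAction G (Fin m)) : G →* TreeAut m :=
  φ.wordHom.codRestrict (TreeAut m) fun g =>
    ⟨fun u => length_truncate _ u, fun u v =>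
      ⟨fun h => by simpa using φ.wordHom_prefix g⁻¹ h, φ.wordHom_prefix g⟩⟩

theorem treeHom_apply (φ : FiniteStateAction G (Fin m)) (g : G) (w : List (Fin m)) :
    (φ.treeHom g).1 w = truncate (φ.act g) w := rfl

/-- The state at `u` is what the machine computes from the machine state reached after reading `u`,
so there are no more states than machine states. -/
theorem isFiniteState_treeHom (φ : FiniteStateAction G (Fin m)) (g : G) :
    TreeAut.IsFiniteState (φ.treeHom g) := by
  obtain ⟨σ, _, M, q, hM⟩ := (φ.finiteState g).exists_truncate_eq
  have hinj : Function.Injective fun β : TreeAut m => (β.1 : List (Fin m) → List (Fin m)) :=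
    DFunLike.coe_injective.comp Subtype.val_injective
  refine Set.Finite.of_finite_image ((Set.finite_range M.runList).subset ?_) hinj.injOn
  rintro _ ⟨_, ⟨u, rfl⟩, rfl⟩
  refine ⟨u.foldl M.next q, funext fun v => ?_⟩
  have := TreeAut.apply_append (φ.treeHom g) u v
  rw [treeHom_apply, treeHom_apply, hM, M.runList_append] at this
  exact List.append_cancel_left this

theorem treeHom_injective (φ : FiniteStateAction G (Fin m)) : Function.Injective φ.treeHom := by
  refine (injective_iff_map_eq_one _).2 fun g hg => φ.faithful g fun s => ?_
  refine congrFun (eq_of_truncate_eq (φ.finiteState g) .id (funext fun w => ?_)) s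
  rw [← treeHom_apply, hg, truncate_id]
  rfl

end

/-- Transport of a finite-state action along a bijection of alphabets, after adding a bit
on which the group acts trivially. -/
def relabel {G : Type*} [Group G] {X Y : Type} (φ : FiniteStateAction G X) (e : X × Bool ≃ Y) :
    FiniteStateAction G Y where
  act g s n := e (φ.act g (fun k => (e.symm (s k)).1) n, (e.symm (s n)).2)
  act_one s := by simp [φ.act_one]
  act_mul g h s := by simp [φ.act_mul]
  faithful g h := φ.faithful g fun s => funext fun n => by
    simpa using congrArg (fun y => (e.symm y).1) (congrFun (h fun n => e (s n, true)) n)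
  finiteState g :=
    (((φ.finiteState g).comp (.map fun x => (e.symm x).1)).prodMk
      (.map fun x => (e.symm x).2)).map_comp e

/-- Restriction of a finite-state action along an injective homomorphism. -/
def restrict {G H : Type*} [Group G] [Group H] {X : Type} (φ : FiniteStateAction H X)
    (f : G →* H) (hf : Function.Injective f) : FiniteStateAction G X where
  act g := φ.act (f g)
  act_one s := by rw [map_one, φ.act_one]
  act_mul g h s := by rw [map_mul, φ.act_mul]
  faithful g h := (map_eq_one_iff f hf).1 (φ.faithful _ h)
  finiteState g := φ.finiteState (f g)

/-- The letterwise action of a group on sequences of its elements. -/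
def regular (G : Type) [Group G] : FiniteStateAction G G where
  act g s n := g * s n
  act_one s := by simp
  act_mul g h s := by simp [mul_assoc]
  faithful g h := by simpa using congrFun (h 1) 0
  finiteState g := .map _

/-- The action of a product of groups on sequences of tuples of letters. -/
def pi {ι : Type} [Finite ι] {G : ι → Type*} [∀ i, Group (G i)] {X : ι → Type}
    [∀ i, Nonempty (X i)] (φ : ∀ i, FiniteStateAction (G i) (X i)) :
    FiniteStateAction (∀ i, G i) (∀ i, X i) where
  act g s n i := (φ i).act (g i) (fun k => s k i) n
  act_one s := by simp [(φ _).act_one]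
  act_mul g h s := by simp [(φ _).act_mul]
  faithful g h := funext fun i => (φ i).faithful _ fun s => funext fun n => by
    classical
    simpa using congrFun (congrFun
      (h fun k => Function.update (fun _ => Classical.ofNonempty) i (s k)) n) i
  finiteState g := .pi fun i => (φ i).finiteState (g i)

/-- The action of a product of two groups on sequences of pairs of letters. -/
def prod {G H : Type*} [Group G] [Group H] {X Y : Type} [Nonempty X] [Nonempty Y]
    (φ : FiniteStateAction G X) (ψ : FiniteStateAction H Y) :
    FiniteStateAction (G × H) (X × Y) where
  act g s n := (φ.act g.1 (fun k => (s k).1) n, ψ.act g.2 (fun k => (s k).2) n)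
  act_one s := by simp [φ.act_one, ψ.act_one]
  act_mul g h s := by simp [φ.act_mul, ψ.act_mul]
  faithful g h := Prod.ext
    (φ.faithful _ fun s => funext fun n =>
      congrArg Prod.fst (congrFun (h fun k => (s k, Classical.ofNonempty)) n))
    (ψ.faithful _ fun s => funext fun n =>
      congrArg Prod.snd (congrFun (h fun k => (Classical.ofNonempty, s k)) n))
  finiteState g :=
    ((φ.finiteState g.1).comp (.map Prod.fst)).prodMk ((ψ.finiteState g.2).comp (.map Prod.snd))

/-- The inert bit added by `relabel` ensures at least two letters, even when `X` is a singleton. -/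
theorem isFiniteStateGroup {G : Type*} [Group G] {X : Type} [Finite X] [Nonempty X]
    (φ : FiniteStateAction G X) : IsFiniteStateGroup G := by
  obtain ⟨m, ⟨e⟩⟩ := Finite.exists_equiv_fin (X × Bool)
  have hm : 2 ≤ m := by
    have h1 : Nat.card (X × Bool) = m := by rw [Nat.card_congr e, Nat.card_fin]
    rw [Nat.card_prod, Nat.card_eq_fintype_card (α := Bool), Fintype.card_bool] at h1
    have := Nat.card_pos (α := X)
    lia
  have : NeZero m := ⟨by lia⟩
  exact ⟨m, hm, (φ.relabel e).treeHom, (φ.relabel e).treeHom_injective,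
    (φ.relabel e).isFiniteState_treeHom⟩

end FiniteStateAction

/-! ### The sparseness test. -/

namespace FiniteStateMap

/-- Detecting whether a letter `true` has been read before the current one is finite-state. -/
theorem exists_lt : FiniteStateMap fun (c : ℕ → Bool) n => decide (∃ i < n, c i = true) := by
  -- The output is the state before the update, so the current letter does not count.
  let M : Mealy Bool Bool Bool := ⟨fun q x => q || x, fun q _ => q⟩
  refine ⟨Bool, inferInstance, M, false, fun c => funext fun n => ?_⟩
  have h : ∀ n, M.trace false c n = decide (∃ i < n, c i = true) := by
    intro n
    induction n with
    | zero => simp [Mealy.trace]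
    | succ n ih =>
      rw [Mealy.trace, ih]
      simp only [M, Nat.exists_lt_succ_right, Bool.decide_or, Bool.decide_eq_true]
  exact (h n).symm

end FiniteStateMap

/-- Whether at most one of the first `n` terms of a sequence is nonzero. -/
def sparse (s : ℕ → ZMod 2) (n : ℕ) : Bool :=
  !decide (∃ j < n, (decide (s j ≠ 0) && decide (∃ i < j, decide (s i ≠ 0) = true)) = true)

theorem finiteStateMap_sparse : FiniteStateMap sparse :=
  (FiniteStateMap.exists_lt.comp ((FiniteStateMap.map fun x : ZMod 2 => decide (x ≠ 0)).map₂
    (FiniteStateMap.exists_lt.comp (.map fun x : ZMod 2 => decide (x ≠ 0))) (· && ·))).map_comp (!·)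

theorem sparse_eq_true {s : ℕ → ZMod 2} {n : ℕ} :
    sparse s n = true ↔ ∀ j < n, s j ≠ 0 → ∀ i < j, s i = 0 := by
  simp [sparse]

open PowerSeries in
/-- The unit `1 + X` of the ring of formal power series. -/
noncomputable def oneAddX : (ZMod 2)⟦X⟧ˣ :=
  (isUnit_iff_constantCoeff.2 (by simp) : IsUnit (1 + X : (ZMod 2)⟦X⟧)).unit

/-! ### The lamplighter group acting on power series over the field of two elements. -/

section Lamplighter

open PowerSeries

theorem coe_oneAddX : (oneAddX : (ZMod 2)⟦X⟧) = 1 + X := rfl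

/-- Multiplying by a power of `1 + X` clears the negative exponents; what remains is a polynomial
with the substitution `X ↦ X + 1`, which is injective. -/
theorem eq_zero_of_sum_smul_oneAddX (S : Finset ℤ) (c : ℤ → ZMod 2)
    (h : ∑ k ∈ S, c k • ((oneAddX ^ k : (ZMod 2)⟦X⟧ˣ) : (ZMod 2)⟦X⟧) = 0) {k : ℤ} (hk : k ∈ S) :
    c k = 0 := by
  obtain ⟨M, hM⟩ : ∃ M : ℤ, ∀ k ∈ S, 0 ≤ k + M := by
    obtain ⟨b, hb⟩ := S.bddBelow
    exact ⟨-b, fun k hk => by have := hb hk; lia⟩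
  have h1 : ∀ k ∈ S, ((oneAddX ^ M : (ZMod 2)⟦X⟧ˣ) : (ZMod 2)⟦X⟧) *
      (c k • ((oneAddX ^ k : (ZMod 2)⟦X⟧ˣ) : (ZMod 2)⟦X⟧)) =
      (Polynomial.taylor 1 (Polynomial.monomial (k + M).toNat (c k)) : Polynomial (ZMod 2)) := by
    intro k hk
    obtain ⟨j, hj⟩ := Int.eq_ofNat_of_zero_le (hM k hk)
    rw [mul_smul_comm, ← Units.val_mul, ← zpow_add, add_comm M, hj, Int.toNat_natCast,
      zpow_natCast, Units.val_pow_eq_pow_val, coe_oneAddX, Polynomial.taylor_monomial]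
    simp [smul_eq_C_mul, add_comm]
  have h2 : ∑ k ∈ S, Polynomial.monomial (k + M).toNat (c k) = 0 := by
    refine Polynomial.taylor_injective 1 ?_
    rw [map_zero, map_sum, ← Polynomial.coe_eq_zero_iff,
      ← mul_zero ((oneAddX ^ M : (ZMod 2)⟦X⟧ˣ) : (ZMod 2)⟦X⟧), ← h, Finset.mul_sum,
      Finset.sum_congr rfl h1]
    exact map_sum (Polynomial.coeToPowerSeries.ringHom) _ _
  have h3 := congrArg (Polynomial.coeff · (k + M).toNat) h2
  simp only [Polynomial.finsetSum_coeff, Polynomial.coeff_monomial, Polynomial.coeff_zero] at h3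
  rw [Finset.sum_eq_single k] at h3
  · simpa using h3
  · intro j hj hjk
    rw [if_neg]
    have := hM j hj
    have := hM k hk
    lia
  · exact fun h => absurd hk h

theorem eq_zero_of_oneAddX_zpow_eq_one {k : ℤ}
    (h : ((oneAddX ^ k : (ZMod 2)⟦X⟧ˣ) : (ZMod 2)⟦X⟧) = 1) : k = 0 := by
  by_contra hk
  have := eq_zero_of_sum_smul_oneAddX {k, 0} 1 (by
    rw [Finset.sum_pair hk, h]
    have h2 : (1 + 1 : ZMod 2) = 0 := by decide
    simp only [Pi.one_apply, zpow_zero, Units.val_one, ← add_smul, h2, zero_smul])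
    (Finset.mem_insert_self k _)
  exact one_ne_zero this

/-- The power series `∑ f(k) (1 + X) ^ k`. -/
noncomputable def lampSeries (f : CyclicInf → CyclicTwo) : (ZMod 2)⟦X⟧ :=
  ∑ᶠ k : CyclicInf, (f k).toAdd • ((oneAddX ^ k.toAdd : (ZMod 2)⟦X⟧ˣ) : (ZMod 2)⟦X⟧)

theorem hasFiniteSupport_lampSeries {f : CyclicInf → CyclicTwo}
    (hf : (Function.mulSupport f).Finite) :
    (Function.support fun k : CyclicInf =>
      (f k).toAdd • ((oneAddX ^ k.toAdd : (ZMod 2)⟦X⟧ˣ) : (ZMod 2)⟦X⟧)).Finite := by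
  refine hf.subset fun k hk hk' => hk ?_
  simp [hk']

theorem lampSeries_mul {f g : CyclicInf → CyclicTwo} (hf : (Function.mulSupport f).Finite)
    (hg : (Function.mulSupport g).Finite) :
    lampSeries (f * g) = lampSeries f + lampSeries g := by
  rw [lampSeries, lampSeries, lampSeries,
    ← finsum_add_distrib (hasFiniteSupport_lampSeries hf) (hasFiniteSupport_lampSeries hg)]
  simp [add_smul]

theorem lampSeries_translate (g : CyclicInf → CyclicTwo) (k : CyclicInf) :
    lampSeries (fun x => g (k⁻¹ * x)) =
      ((oneAddX ^ k.toAdd : (ZMod 2)⟦X⟧ˣ) : (ZMod 2)⟦X⟧) * lampSeries g := by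
  rw [lampSeries, lampSeries, mul_finsum,
    ← finsum_comp_equiv (Equiv.mulLeft k)]
  refine finsum_congr fun x => ?_
  simp [zpow_add]

theorem eq_one_of_lampSeries_eq_zero {f : CyclicInf → CyclicTwo}
    (hf : (Function.mulSupport f).Finite) (h : lampSeries f = 0) : f = 1 := by
  funext k
  by_contra hk
  rw [lampSeries, finsum_eq_sum_of_support_subset (s := hf.toFinset)] at h
  · exact hk (eq_zero_of_sum_smul_oneAddX hf.toFinset (fun k => (f (.ofAdd k)).toAdd) h
      (hf.mem_toFinset.2 hk))
  · intro k hk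
    refine hf.mem_toFinset.2 fun hk' => hk ?_
    simp [hk']

theorem finiteStateMap_oneAddX_mul :
    FiniteStateMap fun s n => coeff n ((oneAddX : (ZMod 2)⟦X⟧) * mk s) := by
  -- The state is the previous input letter.
  let M : Mealy (ZMod 2) (ZMod 2) (ZMod 2) := ⟨fun _ x => x, fun q x => x + q⟩
  refine ⟨ZMod 2, inferInstance, M, 0, fun s => funext fun n => ?_⟩
  change coeff n _ = _
  rw [coe_oneAddX, add_mul, one_mul, map_add, coeff_mk]
  cases n with
  | zero => simp [Mealy.run, Mealy.trace, M]
  | succ n => rw [coeff_succ_X_mul, coeff_mk]; rfl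

theorem finiteStateMap_oneAddX_inv_mul :
    FiniteStateMap fun s n => coeff n (((oneAddX⁻¹ : (ZMod 2)⟦X⟧ˣ) : (ZMod 2)⟦X⟧) * mk s) := by
  -- The state is the previous output letter: `(1 + X) * r = s` is solved by the recursion `r (n +
  -- 1) = s (n + 1) - r n`.
  let M : Mealy (ZMod 2) (ZMod 2) (ZMod 2) := ⟨fun q x => x - q, fun q x => x - q⟩
  refine ⟨ZMod 2, inferInstance, M, 0, fun s => funext fun n => ?_⟩
  set r := ((oneAddX⁻¹ : (ZMod 2)⟦X⟧ˣ) : (ZMod 2)⟦X⟧) * mk s with hr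
  have hs : r + X * r = mk s := by
    rw [hr, ← one_add_mul, ← coe_oneAddX, Units.mul_inv_cancel_left]
  have h0 : coeff 0 r = s 0 := by simpa using congrArg (coeff 0) hs
  have h1 : ∀ n, coeff (n + 1) r = s (n + 1) - coeff n r := fun n => by
    have := congrArg (coeff (n + 1)) hs
    rw [map_add, coeff_succ_X_mul, coeff_mk] at this
    exact eq_sub_of_add_eq this
  have h : ∀ n, M.run 0 s n = coeff n r := by
    intro n
    induction n with
    | zero => simp [Mealy.run, Mealy.trace, M, h0]
    | succ n ih => rw [h1, ← ih]; rfl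
  exact (h n).symm

theorem finiteStateMap_zpow_mul (k : ℤ) :
    FiniteStateMap fun s n => coeff n (((oneAddX ^ k : (ZMod 2)⟦X⟧ˣ) : (ZMod 2)⟦X⟧) * mk s) := by
  have hmk : ∀ p : (ZMod 2)⟦X⟧, mk (fun n => coeff n p) = p := fun p => by ext; simp
  induction k with
  | zero => simpa using FiniteStateMap.id
  | succ k ih =>
    have := finiteStateMap_oneAddX_mul.comp ih
    simpa only [hmk, ← mul_assoc, ← Units.val_mul, ← zpow_one_add, add_comm] using this
  | pred k ih =>
    have := finiteStateMap_oneAddX_inv_mul.comp ih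
    simpa only [hmk, ← mul_assoc, ← Units.val_mul, ← zpow_neg_one, ← zpow_add, ← sub_eq_neg_add]
      using this

theorem finiteStateMap_lampSeries (f : CyclicInf → CyclicTwo) :
    FiniteStateMap fun (_ : ℕ → ZMod 2) n => coeff n (lampSeries f) := by
  refine finsum_induction (p := fun q : (ZMod 2)⟦X⟧ =>
    FiniteStateMap fun (_ : ℕ → ZMod 2) n => coeff n q) ?_ ?_ fun k => ?_
  · exact .map fun _ => 0
  · exact fun p q hp hq => hp.map₂ hq (· + ·)
  · have h1 : FiniteStateMap fun (_ : ℕ → ZMod 2) n => (coeff n (1 : (ZMod 2)⟦X⟧) : ZMod 2) := by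
      -- Started in state `1`, the machine emits `1, 0, 0, …` whatever it reads.
      let M : Mealy (ZMod 2) (ZMod 2) (ZMod 2) := ⟨fun _ _ => 0, fun q _ => q⟩
      refine ⟨ZMod 2, inferInstance, M, 1, fun s => funext fun n => ?_⟩
      change coeff n 1 = _
      rw [coeff_one]
      cases n <;> rfl
    have hmk : ∀ p : (ZMod 2)⟦X⟧, mk (fun n => coeff n p) = p := fun p => by ext; simp
    simpa only [hmk, mul_one, map_smul, smul_eq_mul] using
      ((finiteStateMap_zpow_mul k.toAdd).comp h1).map_comp ((f k).toAdd * ·)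

/-- The lamplighter group acts on `𝔽₂⟦X⟧` by `s ↦ (1 + X) ^ n * s + ∑ f(k) (1 + X) ^ k`. -/
noncomputable def lampAct (q : RestrictedWreath CyclicTwo CyclicInf) (p : (ZMod 2)⟦X⟧) :
    (ZMod 2)⟦X⟧ :=
  ((oneAddX ^ q.1.right.toAdd : (ZMod 2)⟦X⟧ˣ) : (ZMod 2)⟦X⟧) * p + lampSeries q.1.left

theorem lampAct_mul (q r : RestrictedWreath CyclicTwo CyclicInf) (p : (ZMod 2)⟦X⟧) :
    lampAct (q * r) p = lampAct q (lampAct r p) := by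
  have hr : (Function.mulSupport fun x => r.1.left (q.1.right⁻¹ * x)).Finite :=
    r.2.preimage (f := fun x => q.1.right⁻¹ * x) (mul_right_injective _).injOn
  simp only [lampAct, Subgroup.coe_mul, RegularWreathProduct.mul_left,
    RegularWreathProduct.mul_right, lampSeries_mul q.2 hr, lampSeries_translate, toAdd_mul,
    zpow_add, Units.val_mul]
  ring

/-- Away from the identity, an element of the lamplighter group takes only finitely many of the
monomials to a sparse sequence. -/
theorem finite_setOf_sparse_lampAct {q : RestrictedWreath CyclicTwo CyclicInf} (hq : q ≠ 1) :
    {n : ℕ | ∀ N, sparse (fun i => coeff i (lampAct q (X ^ n))) N = true}.Finite := by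
  have key : ∀ p : (ZMod 2)⟦X⟧, (∀ N, sparse (fun i => coeff i p) N = true) →
      ∀ v, coeff v p ≠ 0 → p = monomial v (coeff v p) := by
    intro p hp v hv
    ext i
    rw [coeff_monomial]
    split_ifs with h
    · rw [h]
    · by_contra hi
      rcases lt_or_gt_of_ne h with h | h
      · exact hi (sparse_eq_true.1 (hp (v + 1)) v v.lt_succ_self hv i h)
      · exact hv (sparse_eq_true.1 (hp (i + 1)) i i.lt_succ_self hi v h)
  set u : (ZMod 2)⟦X⟧ˣ := oneAddX ^ q.1.right.toAdd with hu
  by_cases hg : lampSeries q.1.left = 0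
  -- Without translation part, a sparse `u * X ^ n` has its only nonzero coefficient at `n`, so it
  -- equals `X ^ n`; then `u = 1` and `q = 1`.
  · convert Set.finite_empty
    refine Set.eq_empty_of_forall_notMem fun n hn => hq ?_
    have hf := eq_one_of_lampSeries_eq_zero q.2 hg
    have hc : coeff n (lampAct q (X ^ n)) ≠ 0 := by
      rw [lampAct, hg, add_zero, ← hu, coeff_mul_X_pow', if_pos le_rfl, Nat.sub_self,
        coeff_zero_eq_constantCoeff_apply]
      exact (u.isUnit.map _).ne_zero
    have hp := key _ hn n hc
    have h1 : coeff n (lampAct q (X ^ n)) = 1 := by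
      generalize coeff n (lampAct q (X ^ n)) = c at hc
      revert c
      decide
    rw [h1, ← X_pow_eq, lampAct, hg, add_zero, ← hu] at hp
    have h2 : (u : (ZMod 2)⟦X⟧) = 1 :=
      mul_right_cancel₀ (pow_ne_zero n X_ne_zero) (hp.trans (one_mul _).symm)
    have h3 := eq_zero_of_oneAddX_zpow_eq_one h2
    exact Subtype.ext (RegularWreathProduct.ext hf h3)
  · obtain ⟨v, hv⟩ : ∃ v, coeff v (lampSeries q.1.left) ≠ 0 := by
      by_contra! h
      exact hg (by ext v; simp [h v])
    -- For `n > v` the term `u * X ^ n` does not affect coefficient `v`, so a sparse image must be a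
    -- fixed monomial of degree `v`. This determines `u * X ^ n`, hence `n`.
    refine ((Set.finite_Iic v).union (Set.Subsingleton.finite (s := {n : ℕ | (u : (ZMod 2)⟦X⟧) * X ^ n =
      monomial v (coeff v (lampSeries q.1.left)) - lampSeries q.1.left}) ?_)).subset ?_
    · intro n hn n' hn'
      have := u.mul_right_inj.1 (hn.trans hn'.symm)
      simpa [coeff_X_pow] using congrArg (coeff n) this
    · intro n hn
      rcases le_or_gt n v with h | h
      · exact Or.inl h
      · right
        have hc : coeff v (lampAct q (X ^ n)) = coeff v (lampSeries q.1.left) := by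
          rw [lampAct, map_add, coeff_mul_X_pow', if_neg (by lia), zero_add]
        have := key _ hn v (by rwa [hc])
        rw [hc, lampAct] at this
        exact eq_sub_of_add_eq this

theorem exists_sparse_and_not_sparse (F : Finset (RestrictedWreath CyclicTwo CyclicInf))
    (hF : 1 ∉ F) : ∃ (p : (ZMod 2)⟦X⟧) (N : ℕ), sparse (fun i => coeff i p) N = true ∧
      ∀ q ∈ F, sparse (fun i => coeff i (lampAct q p)) N = false := by
  have hfin : (⋃ q ∈ F, {n : ℕ | ∀ N, sparse (fun i => coeff i (lampAct q (X ^ n))) N = true}).Finite :=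
    F.finite_toSet.biUnion fun q hq =>
      finite_setOf_sparse_lampAct (ne_of_mem_of_not_mem hq hF)
  obtain ⟨n, hn⟩ := hfin.exists_notMem
  simp only [Set.mem_iUnion, Set.mem_ofPred_eq, not_exists, not_forall, Bool.not_eq_true] at hn
  choose! N hN using hn
  -- A failure of sparseness persists at later times, so the maximum of the failure times serves
  -- every `q ∈ F`, while `X ^ n` is sparse at all times.
  refine ⟨X ^ n, F.sup N, sparse_eq_true.2 fun j _ hj i hi => ?_, fun q hq => ?_⟩
  · rw [coeff_X_pow] at hj ⊢
    have : j = n := by by_contra h; simp [h] at hj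
    rw [if_neg (by lia)]
  · rw [← Bool.not_eq_true, sparse_eq_true]
    intro h
    have h1 := hN q hq
    rw [← Bool.not_eq_true, sparse_eq_true] at h1
    exact h1 fun j hj => h j (hj.trans_le (Finset.le_sup hq))

/-- The action of the lamplighter group on binary sequences, the coefficients of power series. -/
noncomputable def lamplighterAction :
    FiniteStateAction (RestrictedWreath CyclicTwo CyclicInf) (ZMod 2) where
  act q s n := coeff n (lampAct q (mk s))
  act_one s := by
    have h : lampSeries 1 = 0 := by simp [lampSeries]
    simp [lampAct, h]
  act_mul q r s := by
    have hmk : ∀ p : (ZMod 2)⟦X⟧, mk (fun n => coeff n p) = p := fun p => by ext; simp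
    rw [hmk, lampAct_mul]
  faithful q h := by
    by_contra hq
    obtain ⟨p, N, hp, hN⟩ := exists_sparse_and_not_sparse {q} (by simpa using Ne.symm hq)
    have hmk : mk (fun n => coeff n p) = p := by ext; simp
    have := h fun n => coeff n p
    rw [hmk] at this
    have h2 := hN q (Finset.mem_singleton_self q)
    rw [this, hp] at h2
    cases h2
  finiteState q := by
    simpa only [lampAct, map_add] using
      (finiteStateMap_zpow_mul q.1.right.toAdd).map₂ (finiteStateMap_lampSeries q.1.left) (· + ·)

theorem exists_sparse_lamplighterAction (F : Finset (RestrictedWreath CyclicTwo CyclicInf))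
    (hF : 1 ∉ F) : ∃ (s : ℕ → ZMod 2) (N : ℕ), sparse s N = true ∧
      ∀ q ∈ F, sparse (lamplighterAction.act q s) N = false := by
  obtain ⟨p, N, hp, hN⟩ := exists_sparse_and_not_sparse F hF
  refine ⟨fun i => coeff i p, N, hp, fun q hq => ?_⟩
  have hmk : mk (fun n => coeff n p) = p := by ext; simp
  simpa only [lamplighterAction, hmk] using hN q hq

end Lamplighter

/-! ### Acting on a tail whose starting time is signalled by a gate. -/

section Gating

variable {Y : Type}

/-- The map applying `F` to the tail of a sequence from time `N` on. -/
def delayed (N : ℕ) (F : (ℕ → Y) → ℕ → Y) (y : ℕ → Y) (n : ℕ) : Y :=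
  if n < N then y n else F (fun k => y (N + k)) (n - N)

theorem delayed_comp (N : ℕ) (F G : (ℕ → Y) → ℕ → Y) (y : ℕ → Y) :
    delayed N (fun y => F (G y)) y = delayed N F (delayed N G y) := by
  funext n
  by_cases h : n < N <;> simp [delayed, h]

theorem delayed_id (N : ℕ) (y : ℕ → Y) : delayed N (fun y => y) y = y := by
  funext n
  by_cases h : n < N
  · simp [delayed, h]
  · simp [delayed, h, Nat.add_sub_of_le (not_lt.1 h)]

open scoped Classical in
/-- The map applying `F N` to the tail of a sequence from time `N` on, where `N` is the first time
at which the sequence `b` takes the value `true`. -/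
noncomputable def gated (b : ℕ → Bool) (F : ℕ → (ℕ → Y) → ℕ → Y) (y : ℕ → Y) : ℕ → Y :=
  if h : ∃ n, b n = true then delayed (Nat.find h) (F (Nat.find h)) y else y

theorem gated_comp (b : ℕ → Bool) (F G : ℕ → (ℕ → Y) → ℕ → Y) (y : ℕ → Y) :
    gated b (fun N y => F N (G N y)) y = gated b F (gated b G y) := by
  unfold gated
  split_ifs
  · exact delayed_comp _ _ _ _
  · rfl

theorem gated_id (b : ℕ → Bool) (y : ℕ → Y) : gated b (fun _ y => y) y = y := by
  unfold gated
  split_ifs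
  · exact delayed_id _ _
  · rfl

theorem gated_of_first {b : ℕ → Bool} {N : ℕ} (hN : b N = true) (h : ∀ i < N, b i = false)
    (F : ℕ → (ℕ → Y) → ℕ → Y) (y : ℕ → Y) : gated b F y = delayed N (F N) y := by
  have hb : ∃ n, b n = true := ⟨N, hN⟩
  classical
  have hf : Nat.find hb = N := (Nat.find_eq_iff hb).2 ⟨hN, fun i hi => by simp [h i hi]⟩
  rw [gated, dif_pos hb, hf]

/-- A machine waiting for the gate to open; it then simulates `M` if the condition holds at that
time, and copies its input otherwise. -/
def Mealy.gate {σ : Type} (M : Mealy Y Y σ) (q : σ) :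
    Mealy (Bool × Bool × Y) Y (Option (Option σ)) where
  next
    -- State `none` waits, `some none` copies forever, `some (some p)` simulates. The letter read at
    -- the opening time is already fed to `M`.
    | none, (c, b, y) => if b then some (if c then some (M.next q y) else none) else none
    | some none, _ => some none
    | some (some p), (_, _, y) => some (some (M.next p y))
  out
    | none, (c, b, y) => if b && c then M.out q y else y
    | some none, (_, _, y) => y
    | some (some p), (_, _, y) => M.out p y

/-- The condition is consulted only once, when the gate opens, so its outcome is stored in the
finite state. -/
theorem FiniteStateMap.gate {F : (ℕ → Y) → ℕ → Y} (hF : FiniteStateMap F) :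
    FiniteStateMap fun (z : ℕ → Bool × Bool × Y) =>
      gated (fun n => (z n).2.1) (fun N y => if (z N).1 then F y else y) (fun n => (z n).2.2) := by
  obtain ⟨σ, _, M, q, hM⟩ := hF
  refine ⟨Option (Option σ), inferInstance, M.gate q, none, fun z => ?_⟩
  have hwait : ∀ n, (∀ i < n, (z i).2.1 = false) → (M.gate q).trace none z n = none := by
    intro n hn
    induction n with
    | zero => rfl
    | succ n ih =>
      rw [Mealy.trace, ih fun i hi => hn i (hi.trans n.lt_succ_self)]
      simp [Mealy.gate, hn n n.lt_succ_self]
  have hout : ∀ n, (∀ i ≤ n, (z i).2.1 = false) → (M.gate q).run none z n = (z n).2.2 := by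
    intro n hn
    rw [Mealy.run, hwait n fun i hi => hn i hi.le]
    simp [Mealy.gate, hn n le_rfl]
  by_cases h : ∃ n, (z n).2.1 = true
  · obtain ⟨N, hN, hlt⟩ : ∃ N, (z N).2.1 = true ∧ ∀ i < N, (z i).2.1 = false :=
      ⟨Nat.find h, Nat.find_spec h, fun i hi => by simpa using Nat.find_min h hi⟩
    refine (gated_of_first (b := fun n => (z n).2.1) hN hlt _ _).trans ?_
    have hN' := hwait N hlt
    funext n
    rcases lt_or_ge n N with hn | hn
    · rw [hout n fun i hi => hlt i (hi.trans_lt hn), delayed, if_pos hn]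
    obtain ⟨k, rfl⟩ := Nat.exists_eq_add_of_le hn
    rw [delayed, if_neg (by lia), Nat.add_sub_cancel_left]
    by_cases hc : (z N).1 = true
    · have htr : ∀ k, (M.gate q).trace none z (N + k + 1) =
          some (some (M.trace q (fun k => (z (N + k)).2.2) (k + 1))) := by
        intro k
        induction k with
        | zero => rw [Mealy.trace, hN']; simp [Mealy.gate, hN, hc, Mealy.trace]
        | succ k ih => rw [Mealy.trace, ← add_assoc N k 1, ih]; rfl
      simp only [hc, if_true, hM]
      cases k with
      | zero => simp only [Mealy.run, add_zero, hN']; simp [Mealy.gate, hN, hc, Mealy.trace]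
      | succ k => simp only [Mealy.run, ← add_assoc N k 1, htr]; rfl
    · have htr : ∀ k, (M.gate q).trace none z (N + k + 1) = some none := by
        intro k
        induction k with
        | zero => rw [Mealy.trace, hN']; simp [Mealy.gate, hN, hc]
        | succ k ih => rw [Mealy.trace, ← add_assoc N k 1, ih]; rfl
      simp only [hc]
      cases k with
      | zero => rw [Mealy.run, add_zero, hN']; simp [Mealy.gate, hN, hc]
      | succ k => rw [Mealy.run, ← add_assoc N k 1, htr]; rfl
  · refine (dif_neg h).trans ?_
    push Not at h
    funext n
    exact (hout n fun i _ => by simpa using h i).symm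

end Gating

/-! ### The action of a wreath product with abelian base. -/

section Wreath

variable {A Q : Type*} [CommGroup A] [Group Q] {X Y : Type}

/-- The product of the values `f p` over those `p` for which the translate of `x` by `p⁻¹` satisfies
the condition `χ` at time `N`. -/
noncomputable def wreathWeight (φ : FiniteStateAction Q X) (χ : (ℕ → X) → ℕ → Bool) (f : Q → A)
    (x : ℕ → X) (N : ℕ) : A :=
  ∏ᶠ p, if χ (φ.act p⁻¹ x) N then f p else 1

theorem hasFiniteMulSupport_ite {ι : Type*} {f : ι → A} (hf : (Function.mulSupport f).Finite)
    (c : ι → Bool) :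
    (Function.mulSupport fun p => if c p then f p else 1).Finite :=
  hf.subset fun p hp hp' => hp (by simp [hp'])

theorem wreathWeight_mul (φ : FiniteStateAction Q X) (χ : (ℕ → X) → ℕ → Bool) {f g : Q → A}
    (hf : (Function.mulSupport f).Finite) (hg : (Function.mulSupport g).Finite) (x : ℕ → X)
    (N : ℕ) :
    wreathWeight φ χ (f * g) x N = wreathWeight φ χ f x N * wreathWeight φ χ g x N := by
  rw [wreathWeight, wreathWeight, wreathWeight,
    ← finprod_mul_distrib (hasFiniteMulSupport_ite hf _) (hasFiniteMulSupport_ite hg _)]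
  refine finprod_congr fun p => ?_
  split_ifs <;> simp

/-- Substituting `q * p` for `p` cancels `q`. With `wreathWeight_mul` this is the cocycle identity
behind multiplicativity of the wreath action. -/
theorem wreathWeight_translate (φ : FiniteStateAction Q X) (χ : (ℕ → X) → ℕ → Bool) (g : Q → A)
    (q : Q) (x : ℕ → X) (N : ℕ) :
    wreathWeight φ χ (fun p => g (q⁻¹ * p)) (φ.act q x) N = wreathWeight φ χ g x N := by
  rw [wreathWeight, wreathWeight, ← finprod_comp_equiv (Equiv.mulLeft q)]
  refine finprod_congr fun p => ?_
  simp [← φ.act_mul]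

/-- Gated maps with a common gate compose, since gating leaves the gate sequence alone. The product
over `S` thus becomes a cascade of single-factor gates, each covered by `FiniteStateMap.gate`. -/
theorem FiniteStateMap.gated_prod {Z : Type} (ψ : FiniteStateAction A Y) {ι : Type*} (S : Finset ι)
    (f : ι → A) {c : ι → (ℕ → Z) → ℕ → Bool} (hc : ∀ p, FiniteStateMap (c p))
    {b : (ℕ → Z) → ℕ → Bool} (hb : FiniteStateMap b) {y : (ℕ → Z) → ℕ → Y}
    (hy : FiniteStateMap y) :
    FiniteStateMap fun z =>
      gated (b z) (fun N => ψ.act (∏ p ∈ S, if c p z N then f p else 1)) (y z) := by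
  classical
  induction S using Finset.induction_on with
  | empty =>
    convert hy using 2 with z
    simpa [funext ψ.act_one] using gated_id (b z) (y z)
  | insert p S hp ih =>
    convert (ψ.finiteState (f p)).gate.comp ((hc p).prodMk (hb.prodMk ih)) using 2 with z
    rw [← gated_comp]
    congr 1
    funext N y
    rw [Finset.prod_insert hp, ψ.act_mul]
    split_ifs
    · rfl
    · rw [ψ.act_one]

/-- The action of a restricted wreath product with abelian base on sequences of triples, obtained
from finite-state actions of the factors. The letters of the second component open a gate, after
which the third component is acted upon by an element of the base. -/
noncomputable def FiniteStateAction.wreath [Nonempty Y] (ψ : FiniteStateAction A Y)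
    (φ : FiniteStateAction Q X) {χ : (ℕ → X) → ℕ → Bool} (hχ : FiniteStateMap χ)
    (hsep : ∀ F : Finset Q, 1 ∉ F →
      ∃ x N, χ x N = true ∧ ∀ q ∈ F, χ (φ.act q x) N = false) :
    FiniteStateAction (RestrictedWreath A Q) (X × Bool × Y) where
  act g z n := (φ.act g.1.right (fun k => (z k).1) n, (z n).2.1,
    gated (fun k => (z k).2.1)
      (fun N => ψ.act (wreathWeight φ χ g.1.left (φ.act g.1.right fun k => (z k).1) N))
      (fun k => (z k).2.2) n)
  act_one z := by
    have h : ∀ x N, wreathWeight φ χ (1 : Q → A) x N = 1 := by simp [wreathWeight]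
    have h1 := gated_id (fun k => (z k).2.1) (fun k => (z k).2.2)
    simp [h, φ.act_one, funext ψ.act_one, h1]
  act_mul g h z := by
    have hh : (Function.mulSupport fun x => h.1.left (g.1.right⁻¹ * x)).Finite :=
      h.2.preimage (f := fun x => g.1.right⁻¹ * x) (mul_right_injective _).injOn
    simp only [Subgroup.coe_mul, RegularWreathProduct.mul_left, RegularWreathProduct.mul_right,
      φ.act_mul, wreathWeight_mul φ χ g.2 hh, wreathWeight_translate, ← gated_comp, ← ψ.act_mul]
  faithful g hg := by
    classical
    have hr : g.1.right = 1 := φ.faithful _ fun x => funext fun n =>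
      congrArg Prod.fst (congrFun (hg fun k => (x k, false, Classical.ofNonempty)) n)
    refine Subtype.ext (RegularWreathProduct.ext (funext fun p₀ => ?_) hr)
    change g.1.left p₀ = 1
    have hfin : (Function.mulSupport g.1.left).Finite := g.2
    -- At the point `p₀ x` the factor indexed by `p` tests `p⁻¹ p₀ x`; excluding all support points
    -- other than `p₀` leaves exactly `f p₀` as the weight.
    obtain ⟨x, N, hx, hF⟩ := hsep ((hfin.toFinset.erase p₀).image fun p => p⁻¹ * p₀) (by
      simp only [Finset.mem_image, Finset.mem_erase, not_exists, not_and]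
      exact fun p hp h => hp.1 (inv_mul_eq_one.1 h))
    have hw : wreathWeight φ χ g.1.left (φ.act p₀ x) N = g.1.left p₀ := by
      rw [wreathWeight, finprod_eq_single _ p₀]
      · rw [← φ.act_mul, inv_mul_cancel, φ.act_one, if_pos hx]
      · intro p hp
        by_cases h : g.1.left p = 1
        · simp [h]
        · rw [← φ.act_mul, hF _ (Finset.mem_image_of_mem _ (Finset.mem_erase.2
            ⟨hp, hfin.mem_toFinset.2 h⟩))]
          simp
    refine ψ.faithful _ fun y => funext fun n => ?_
    -- The gate opens at `N` and `y` is delayed by `N`, so the tail acted upon is `y` itself; the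
    -- letters before `N` play no role.
    have := congrArg (fun t => t.2.2)
      (congrFun (hg fun k => (φ.act p₀ x k, decide (k = N), y (k - N))) (N + n))
    simpa [gated_of_first (b := fun k => decide (k = N)) (N := N) (by simp)
      (fun i hi => by simp [hi.ne]), delayed, hr, φ.act_one, hw] using this
  finiteState g := by
    have hx : FiniteStateMap fun (z : ℕ → X × Bool × Y) => φ.act g.1.right fun k => (z k).1 :=
      (φ.finiteState _).comp (.map Prod.fst)
    have hfin : (Function.mulSupport g.1.left).Finite := g.2
    refine hx.prodMk ((FiniteStateMap.map fun t : X × Bool × Y => t.2.1).prodMk ?_)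
    convert FiniteStateMap.gated_prod ψ hfin.toFinset g.1.left
      (fun p => hχ.comp ((φ.finiteState p⁻¹).comp hx)) (.map fun t : X × Bool × Y => t.2.1)
      (.map fun t : X × Bool × Y => t.2.2)
      using 5 with z N
    refine finprod_eq_prod_of_mulSupport_subset _ fun p hp => hfin.mem_toFinset.2 fun hp' => hp ?_
    simp [hp']

end Wreath

/-! ### Finitely generated abelian groups and the conclusion. -/

/-- The infinite cyclic group acts through its embedding into the lamplighter group. -/
noncomputable def cyclicInfAction : FiniteStateAction CyclicInf (ZMod 2) :=
  lamplighterAction.restrict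
    ((RegularWreathProduct.inl : CyclicInf →* RegularWreathProduct CyclicTwo CyclicInf).codRestrict
      -- Membership concerns only the function part, which is trivial on the image of `inl`, as it
      -- is for the identity.
      (restrictedWreath CyclicTwo CyclicInf) fun _ => (restrictedWreath CyclicTwo CyclicInf).one_mem)
    fun _ _ h => congrArg (fun x => x.1.right) h

/-- By the structure theorem, `A` is a finite product of copies of `ℤ`, acting by powers of `1 + X`,
and finite cyclic groups, acting letterwise on themselves. -/
theorem exists_finiteStateAction_of_fg (A : Type*) [CommGroup A] [Group.FG A] :
    ∃ (Y : Type) (_ : Finite Y) (_ : Nonempty Y), Nonempty (FiniteStateAction A Y) := by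
  obtain ⟨ι, j, _, _, p, hp, e, ⟨f⟩⟩ := CommGroup.equiv_free_prod_prod_multiplicative_zmod A
  have : ∀ i, NeZero (p i ^ e i) := fun i => ⟨pow_ne_zero _ (hp i).ne_zero⟩
  have : ∀ i, Finite (Multiplicative (ZMod (p i ^ e i))) := fun i =>
    inferInstanceAs (Finite (ZMod (p i ^ e i)))
  exact ⟨_, inferInstance, inferInstance, ⟨((FiniteStateAction.pi fun _ : j => cyclicInfAction).prod
    (.pi fun i : ι => .regular (Multiplicative (ZMod (p i ^ e i))))).restrict f.toMonoidHom
      f.injective⟩⟩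

theorem isFiniteStateGroup_wreath_lamplighter (A : Type*) [CommGroup A] [Group.FG A] :
    IsFiniteStateGroup (RestrictedWreath A (RestrictedWreath CyclicTwo CyclicInf)) := by
  obtain ⟨Y, _, _, ⟨ψ⟩⟩ := exists_finiteStateAction_of_fg A
  exact (ψ.wreath lamplighterAction finiteStateMap_sparse
    exists_sparse_lamplighterAction).isFiniteStateGroup

theorem corollary4p3 :
    (∀ (A : Type*) [CommGroup A] [Group.FG A],
      IsFiniteStateGroup (RestrictedWreath A (RestrictedWreath CyclicTwo CyclicInf))) ∧
    IsFiniteStateGroup (RestrictedWreath CyclicTwo (RestrictedWreath CyclicTwo CyclicInf)) ∧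
    IsFiniteStateGroup (RestrictedWreath CyclicInf (RestrictedWreath CyclicTwo CyclicInf)) :=
  ⟨fun A _ _ => isFiniteStateGroup_wreath_lamplighter A,
    isFiniteStateGroup_wreath_lamplighter CyclicTwo,
    isFiniteStateGroup_wreath_lamplighter CyclicInf⟩
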